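/- Let $n\ge 2$, and let $\mathcal O_n$ be the Cuntz algebra, i.e. the universal unital $\mathrm C^*$-algebra generated by elements $S_1,\dots,S_n$ with $S_i^*S_j=\delta_{ij}1$ and $\sum_{k}S_kS_k^*=1$. Let $E$ be the $\mathrm C^*$-correspondence over $A=\mathrm C(\mathcal G^0)=\mathbb C$ of the graph $\mathcal G$ with one vertex and $n$ loops: $E=\mathrm C(\mathcal G^1)$ is an $n$-dimensional Hilbert space with orthonormal basis $e_1,\dots,e_n$ of edges and scalar left action. Put $k_E(e_i)=S_i$ (extended linearly) and $k_A(a)=a1$. Let $z_1,\dots,z_n\in\mathrm C(\mathbb T^n)$ be the coordinate functions, let $\Delta(f)(s,t)=f(st)$ be the comultiplication of $\mathrm C(\mathbb T^n)$, and let $u=\sum_{k=1}^n S_kS_k^*\otimes z_k\in\mathcal O_n\otimes\mathrm C(\mathbb T^n)$. Then the following hold. 1. $\mathcal O_n$ with $(k_E,k_A)$ is the Pimsner algebra of $E$: $(k_E,k_A)$ is a covariant representation, and every covariant representation $(t,\pi)$ of $E$ on a unital $\mathrm C^*$-algebra $B$ factors through it by a unique unital $*$-homomorphism $\mathcal O_n\to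 B$. 2. There is a unique unital $*$-homomorphism $\rho:\mathcal O_n\to\mathcal O_n\otimes\mathrm C(\mathbb T^n)$ with $\rho(S_i)=(S_i\otimes 1)u$ for all $i$. It is an action of $\mathbb T^n$: $(\rho\otimes\mathrm{id})\circ\rho=(\mathrm{id}\otimes\Delta)\circ\rho$, and the linear span of $\rho(\mathcal O_n)(1\otimes\mathrm C(\mathbb T^n))$ is dense in $\mathcal O_n\otimes\mathrm C(\mathbb T^n)$. 3. $\rho$ is gauge-equivariant: $(\gamma_z\otimes\mathrm{id})\circ\rho=\rho\circ\gamma_z$ for all $z\in\mathbb T$, where $\gamma$ is the gauge action, i.e. the strongly continuous action of $\mathbb T$ on $\mathcal O_n$ by $*$-automorphisms with $\gamma_z(S_i)=zS_i$. 4. $\rho$ is non-linear: there are no $q_{ij}\in\mathrm C(\mathbb T^n)$ with $\rho(S_j)=\sum_{i=1}^n S_i\otimes q_{ij}$ for all $j$. 5. $\rho$ is not a lift of an action on the correspondence $E$: there are no action $\alpha:A\to A\otimes\mathrm C(\mathbb T^n)$ of $\mathbb T^n$ on $A$ and linear map $\lambda:E\to E\otimes\mathrm C(\mathbb T^n)$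 making $E$ a $\mathbb T^n$-equivariant $\mathrm C^*$-correspondence over $(A,\alpha)$ such that $\rho\circ k_E=(k_E\otimes\mathrm{id})\circ\lambda$ and $\rho\circ k_A=(k_A\otimes\mathrm{id})\circ\alpha$. Here equivariance means: $\lambda(\xi a)=\lambda(\xi)\alpha(a)$, $\langle\lambda(\xi),\lambda(\eta)\rangle=\alpha(\langle\xi,\eta\rangle)$, $\lambda(a\xi)=\alpha(a)\lambda(\xi)$ for the left action, $(\lambda\otimes\mathrm{id})\circ\lambda=(\mathrm{id}\otimes\Delta)\circ\lambda$, and $\lambda(E)(1\otimes\mathrm C(\mathbb T^n))$ spans a dense subspace of $E\otimes\mathrm C(\mathbb T^n)$. -/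

import Mathlib

/-- The free unital complex `*`-algebra on `s₀, …, s_{n-1}`: complex combinations of words in the
letters `(i, false)`, standing for `s_i`, and `(i, true)`, standing for `s_i^*`. -/
abbrev FreeStarAlgebra (n : ℕ) : Type := MonoidAlgebra ℂ (FreeMonoid (Fin n × Bool))

namespace FreeStarAlgebra

/-- The letter `x`, as an element of the free `*`-algebra. -/
noncomputable def letter {n : ℕ} (x : Fin n × Bool) : FreeStarAlgebra n :=
  MonoidAlgebra.of ℂ (FreeMonoid (Fin n × Bool)) (FreeMonoid.of x)

/-- The generator `s_i`. -/
noncomputable def gen {n : ℕ} (i : Fin n) : FreeStarAlgebra n := letter (i, false)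

/-- The involution, as a conjugate-linear ring homomorphism to the opposite ring exchanging
`s_i` and `s_i^*`. -/
noncomputable def invol (n : ℕ) : FreeStarAlgebra n →+* (FreeStarAlgebra n)ᵐᵒᵖ :=
  MonoidAlgebra.liftNCRingHom
    ((algebraMap ℂ (FreeStarAlgebra n)ᵐᵒᵖ).comp (starRingEnd ℂ))
    (FreeMonoid.lift fun x => MulOpposite.op (letter (x.1, !x.2)))
    (fun c w => by
      rw [RingHom.comp_apply]
      exact Algebra.commute_algebraMap_left (A := (FreeStarAlgebra n)ᵐᵒᵖ) _ _)

theorem invol_single_one {n : ℕ} (c : ℂ) :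
    invol n (MonoidAlgebra.single 1 c) = algebraMap ℂ _ (starRingEnd ℂ c) := by
  simp [invol, MonoidAlgebra.liftNCRingHom]

theorem invol_letter {n : ℕ} (x : Fin n × Bool) :
    invol n (letter x) = MulOpposite.op (letter (x.1, !x.2)) := by
  simp [invol, letter, MonoidAlgebra.liftNCRingHom, ← MonoidAlgebra.one_def]

theorem invol_invol {n : ℕ} (x : FreeStarAlgebra n) : (invol n (invol n x).unop).unop = x := by
  have h : ((invol n).op.comp (invol n)) =
      (RingEquiv.opOp (FreeStarAlgebra n)).toRingHom := by
    refine MonoidAlgebra.ringHom_ext' (RingHom.ext fun c => ?_) (FreeMonoid.hom_eq fun x => ?_)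
    · simp [invol_single_one, MulOpposite.algebraMap_apply]
    · change MulOpposite.op (invol n (invol n (letter x)).unop) =
        MulOpposite.op (MulOpposite.op (letter x))
      simp [invol_letter]
  have := DFunLike.congr_fun h x
  simpa using congrArg (fun y => y.unop.unop) this

noncomputable instance {n : ℕ} : StarRing (FreeStarAlgebra n) where
  star x := (invol n x).unop
  star_involutive := invol_invol
  star_mul x y := by simp
  star_add x y := by simp

theorem star_def {n : ℕ} (x : FreeStarAlgebra n) : star x = (invol n x).unop := rfl

instance {n : ℕ} : StarModule ℂ (FreeStarAlgebra n) where
  star_smul c x := by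
    have h : star (algebraMap ℂ (FreeStarAlgebra n) c) = algebraMap ℂ _ (star c) := by
      change (invol n (MonoidAlgebra.single 1 c)).unop = _
      rw [invol_single_one]
      rfl
    rw [Algebra.smul_def, star_mul, h, Algebra.smul_def, Algebra.commutes]

theorem star_letter {n : ℕ} (x : Fin n × Bool) : star (letter x) = letter (x.1, !x.2) := by
  rw [star_def, invol_letter, MulOpposite.unop_op]

end FreeStarAlgebra

/-- `p` is a C*-seminorm on the free `*`-algebra that annihilates the Cuntz relations
`s_i^* s_j = δ_{ij}` and `∑_i s_i s_i^* = 1`. -/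
structure IsCuntzSeminorm {n : ℕ} (p : Seminorm ℂ (FreeStarAlgebra n)) : Prop where
  mul_le : ∀ x y, p (x * y) ≤ p x * p y
  star_mul_self : ∀ x, p (star x * x) = p x ^ 2
  orthonormal : ∀ i j, p (star (FreeStarAlgebra.gen i) * FreeStarAlgebra.gen j - if i = j then 1 else 0) = 0
  complete : p (∑ i, FreeStarAlgebra.gen i * star (FreeStarAlgebra.gen i) - 1) = 0

namespace IsCuntzSeminorm

open FreeStarAlgebra

variable {n : ℕ} {p : Seminorm ℂ (FreeStarAlgebra n)}

theorem star_eq (hp : IsCuntzSeminorm p) (x : FreeStarAlgebra n) : p (star x) = p x := by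
  have key : ∀ y, p y ≤ p (star y) := fun y => by
    have h := hp.mul_le (star y) y
    rw [hp.star_mul_self, pow_two] at h
    rcases (apply_nonneg p y).eq_or_lt with h0 | h0
    · rw [← h0]; exact apply_nonneg p _
    · exact le_of_mul_le_mul_right h h0
  refine le_antisymm ?_ (key x)
  simpa using key (star x)

theorem one_le (hp : IsCuntzSeminorm p) : p 1 ≤ 1 := by
  have h := hp.star_mul_self 1
  rw [star_one, mul_one] at h
  nlinarith [apply_nonneg p 1, sq_nonneg (p 1 - 1)]

theorem gen_le (hp : IsCuntzSeminorm p) (i : Fin n) : p (gen i) ≤ 1 := by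
  have h := hp.orthonormal i i
  have h1 : p (star (gen i) * gen i) ≤ 1 := by
    calc p (star (gen i) * gen i) = p ((star (gen i) * gen i - 1) + 1) := by rw [sub_add_cancel]
      _ ≤ p (star (gen i) * gen i - 1) + p 1 := map_add_le_add p _ _
      _ ≤ 1 := by
        rw [if_pos rfl] at h
        linarith [hp.one_le]
  rw [hp.star_mul_self] at h1
  nlinarith [apply_nonneg p (gen i)]

theorem letter_le (hp : IsCuntzSeminorm p) (x : Fin n × Bool) : p (letter x) ≤ 1 := by
  obtain ⟨i, b⟩ := x
  cases b
  · exact hp.gen_le i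
  · have h := hp.star_eq (gen i)
    rw [gen, star_letter] at h
    exact h.le.trans (hp.gen_le i)

end IsCuntzSeminorm

namespace FreeStarAlgebra

theorem bddAbove {n : ℕ} (x : FreeStarAlgebra n) :
    BddAbove (Set.range fun p : {p : Seminorm ℂ (FreeStarAlgebra n) // IsCuntzSeminorm p} =>
      p.1 x) := by
  suffices h : ∃ C : ℝ, ∀ p : Seminorm ℂ (FreeStarAlgebra n), IsCuntzSeminorm p → p x ≤ C by
    obtain ⟨C, hC⟩ := h
    exact ⟨C, by rintro _ ⟨p, rfl⟩; exact hC p.1 p.2⟩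
  induction x using MonoidAlgebra.induction_on with
  | of w =>
    refine ⟨1, fun p hp => ?_⟩
    induction w using FreeMonoid.inductionOn' with
    | one => rw [map_one]; exact hp.one_le
    | of_mul x w ih =>
      rw [map_mul]
      exact (hp.mul_le _ _).trans
        (mul_le_one₀ (hp.letter_le x) (apply_nonneg p _) ih)
  | add x y hx hy =>
    obtain ⟨C, hC⟩ := hx
    obtain ⟨D, hD⟩ := hy
    exact ⟨C + D, fun p hp => (map_add_le_add p _ _).trans (add_le_add (hC p hp) (hD p hp))⟩
  | smul c x hx =>
    obtain ⟨C, hC⟩ := hx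
    exact ⟨‖c‖ * C, fun p hp => by
      rw [map_smul_eq_mul]; exact mul_le_mul_of_nonneg_left (hC p hp) (norm_nonneg c)⟩

theorem zero_isCuntzSeminorm (n : ℕ) : IsCuntzSeminorm (0 : Seminorm ℂ (FreeStarAlgebra n)) where
  mul_le x y := by simp
  star_mul_self x := by simp
  orthonormal i j := by simp
  complete := by simp

instance (n : ℕ) : Nonempty {p : Seminorm ℂ (FreeStarAlgebra n) // IsCuntzSeminorm p} :=
  ⟨⟨0, zero_isCuntzSeminorm n⟩⟩

/-- The largest C*-seminorm on the free `*`-algebra that annihilates the Cuntz relations. -/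
noncomputable def cuntzNorm {n : ℕ} (x : FreeStarAlgebra n) : ℝ :=
  ⨆ p : {p : Seminorm ℂ (FreeStarAlgebra n) // IsCuntzSeminorm p}, p.1 x

theorem le_cuntzNorm {n : ℕ} {p : Seminorm ℂ (FreeStarAlgebra n)} (hp : IsCuntzSeminorm p)
    (x : FreeStarAlgebra n) : p x ≤ cuntzNorm x :=
  le_ciSup (bddAbove x) ⟨p, hp⟩

theorem cuntzNorm_nonneg {n : ℕ} (x : FreeStarAlgebra n) : 0 ≤ cuntzNorm x :=
  le_cuntzNorm (zero_isCuntzSeminorm n) x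

theorem cuntzNorm_star_mul_self {n : ℕ} (x : FreeStarAlgebra n) :
    cuntzNorm (star x * x) = cuntzNorm x * cuntzNorm x := by
  refine le_antisymm (ciSup_le fun p => ?_) ?_
  · rw [p.2.star_mul_self, pow_two]
    exact mul_self_le_mul_self (apply_nonneg p.1 x) (le_cuntzNorm p.2 x)
  · refine (mul_self_le_mul_self (cuntzNorm_nonneg x) (ciSup_le fun p => ?_)).trans
      (Real.mul_self_sqrt (cuntzNorm_nonneg _)).le
    refine Real.le_sqrt_of_sq_le ?_
    rw [← p.2.star_mul_self]
    exact le_cuntzNorm p.2 _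

noncomputable instance {n : ℕ} : SeminormedRing (FreeStarAlgebra n) :=
  RingSeminorm.toSeminormedRing
    { toFun := cuntzNorm
      map_zero' := le_antisymm (ciSup_le fun p => (map_zero p.1).le) (cuntzNorm_nonneg 0)
      add_le' := fun x y => ciSup_le fun p => (map_add_le_add p.1 x y).trans
        (add_le_add (le_cuntzNorm p.2 x) (le_cuntzNorm p.2 y))
      neg' := fun x => by simp [cuntzNorm]
      mul_le' := fun x y => ciSup_le fun p => (p.2.mul_le x y).trans
        (mul_le_mul (le_cuntzNorm p.2 x) (le_cuntzNorm p.2 y) (apply_nonneg _ _)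
          (cuntzNorm_nonneg x)) }

noncomputable instance {n : ℕ} : NormedAlgebra ℂ (FreeStarAlgebra n) where
  norm_smul_le c x := ciSup_le fun p => by
    rw [map_smul_eq_mul]
    exact mul_le_mul_of_nonneg_left (le_cuntzNorm p.2 x) (norm_nonneg c)

theorem norm_star_mul_self {n : ℕ} (x : FreeStarAlgebra n) : ‖star x * x‖ = ‖x‖ * ‖x‖ :=
  cuntzNorm_star_mul_self x

theorem norm_star {n : ℕ} (x : FreeStarAlgebra n) : ‖star x‖ = ‖x‖ :=
  congrArg iSup (funext fun p => p.2.star_eq x)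

theorem isometry_star {n : ℕ} : Isometry (star : FreeStarAlgebra n → FreeStarAlgebra n) :=
  AddMonoidHomClass.isometry_of_norm (starAddEquiv : FreeStarAlgebra n ≃+ FreeStarAlgebra n)
    norm_star

end FreeStarAlgebra

/-- The Cuntz algebra `𝒪_n`, the universal unital C*-algebra generated by `S_i`, `i < n`, with
`S_i^* S_j = δ_{ij}` and `∑_i S_i S_i^* = 1`: the separated completion of the free `*`-algebra with
respect to the largest C*-seminorm annihilating the relations. -/
abbrev CuntzAlgebra (n : ℕ) : Type := UniformSpace.Completion (FreeStarAlgebra n)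

namespace CuntzAlgebra

open UniformSpace FreeStarAlgebra

noncomputable instance {n : ℕ} : Star (CuntzAlgebra n) := ⟨Completion.map star⟩

theorem continuous_star' {n : ℕ} : Continuous (star : CuntzAlgebra n → CuntzAlgebra n) :=
  Completion.continuous_map

theorem coe_star {n : ℕ} (x : FreeStarAlgebra n) :
    ((star x : FreeStarAlgebra n) : CuntzAlgebra n) =
    star (x : CuntzAlgebra n) :=
  (Completion.map_coe isometry_star.uniformContinuous x).symm

noncomputable instance {n : ℕ} : StarRing (CuntzAlgebra n) where
  star_involutive x := by
    induction x using Completion.induction_on with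
    | hp => exact isClosed_eq (continuous_star'.comp continuous_star') continuous_id
    | ih x => rw [← coe_star, ← coe_star, star_star]
  star_mul x y := by
    induction x, y using Completion.induction_on₂ with
    | hp => exact isClosed_eq (continuous_star'.comp continuous_mul)
              ((continuous_star'.comp continuous_snd).mul (continuous_star'.comp continuous_fst))
    | ih x y => simp only [← coe_star, ← Completion.coe_mul, star_mul]
  star_add x y := by
    induction x, y using Completion.induction_on₂ with
    | hp => exact isClosed_eq (continuous_star'.comp continuous_add)
              ((continuous_star'.comp continuous_fst).add (continuous_star'.comp continuous_snd))
    | ih x y => simp only [← coe_star, ← Completion.coe_add, star_add]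

noncomputable instance {n : ℕ} : CStarAlgebra (CuntzAlgebra n) where
  norm_smul_le := norm_smul_le
  norm_mul_self_le x := by
    induction x using Completion.induction_on with
    | hp => exact isClosed_le (continuous_norm.mul continuous_norm)
              (continuous_norm.comp (continuous_star'.mul continuous_id))
    | ih x => rw [← coe_star, ← Completion.coe_mul, Completion.norm_coe, Completion.norm_coe,
                norm_star_mul_self]
  star_smul c x := by
    induction x using Completion.induction_on with
    | hp => exact isClosed_eq (continuous_star'.comp (continuous_const_smul c))
              ((continuous_const_smul _).comp continuous_star')
    | ih x => rw [← Completion.coe_smul, ← coe_star, ← coe_star, ← Completion.coe_smul, star_smul]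

/-- The generator `S_i`. -/
noncomputable def S {n : ℕ} (i : Fin n) : CuntzAlgebra n :=
  ((gen i : FreeStarAlgebra n) : CuntzAlgebra n)

end CuntzAlgebra

/-! ### Tensor products with `C(X)` -/

/-- For a compact space `X`, the C*-tensor product `A ⊗ C(X)` is the C*-algebra `C(X, A)`, and the
external tensor product `E ⊗ C(X)` of a Hilbert module `E` is `C(X, E)` with pointwise operations.
This is the elementary tensor `a ⊗ f`, the function `x ↦ f x • a`. -/
noncomputable def tmul {X E : Type*} [TopologicalSpace X] [NormedAddCommGroup E] [NormedSpace ℂ E]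
    (a : E) (f : C(X, ℂ)) : C(X, E) :=
  ⟨fun x => f x • a, by fun_prop⟩

/-- `(δ ⊗ id)(F) ∈ E ⊗ C(G) ⊗ C(G) = C(G × G, E)` for `δ : E → E ⊗ C(G)` and `F ∈ E ⊗ C(G)`. -/
def tensorId {G E : Type*} [TopologicalSpace G] [TopologicalSpace E]
    (δ : E → C(G, E)) (F : C(G, E)) : G × G → E :=
  fun p => δ (F p.2) p.1

/-- `(id ⊗ Δ)(F) ∈ E ⊗ C(G) ⊗ C(G) = C(G × G, E)` for `F ∈ E ⊗ C(G)`, where `Δ` is the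
comultiplication `Δ(f)(s, t) = f(st)` of `C(G)`. -/
def idTensorComul {G E : Type*} [TopologicalSpace G] [Mul G] [TopologicalSpace E]
    (F : C(G, E)) : G × G → E :=
  fun p => F (p.1 * p.2)

/-- `α : A → A ⊗ C(G)` is an action of the compact group `G`, seen as the compact quantum group
`(C(G), Δ)`, on the unital C*-algebra `A`. -/
structure IsGAction {G A : Type*} [Group G] [TopologicalSpace G] [CompactSpace G]
    [CStarAlgebra A] (α : A →⋆ₐ[ℂ] C(G, A)) : Prop where
  coassoc : ∀ a, tensorId α (α a) = idTensorComul (α a)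
  podles : closure (Submodule.span ℂ {F : C(G, A) | ∃ a f, F = α a * tmul 1 f} : Set C(G, A)) =
    Set.univ

/-! ### C*-correspondences, their equivariant versions and Pimsner algebras -/

/-- A C*-correspondence `(E, φ)` over the unital C*-algebra `A`, with `E` finitely generated and
projective (fullness of `E` is not imposed). The right action is `ξ · a = act (op a) ξ`. -/
structure CStarCorrespondence (A E : Type*) [CStarAlgebra A] [NormedAddCommGroup E]
    [NormedSpace ℂ E] where
  complete : CompleteSpace E
  act : Aᵐᵒᵖ →ₐ[ℂ] Module.End ℂ E
  inner : E → E → A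
  inner_add_right : ∀ ξ η ζ, inner ξ (η + ζ) = inner ξ η + inner ξ ζ
  inner_act_right : ∀ ξ η a, inner ξ (act (MulOpposite.op a) η) = inner ξ η * a
  star_inner : ∀ ξ η, star (inner ξ η) = inner η ξ
  inner_self_nonneg : ∀ ξ, ∃ b, inner ξ ξ = star b * b
  norm_sq : ∀ ξ, ‖ξ‖ ^ 2 = ‖inner ξ ξ‖
  /-- Finite generation and projectivity: the identity of `E` is a finite sum of rank-one
  operators. -/
  exists_frame : ∃ (m : ℕ) (u v : Fin m → E), ∀ ξ,
    ξ = ∑ i, act (MulOpposite.op (inner (v i) ξ)) (u i)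
  /-- The left action, a unital `*`-homomorphism into the adjointable operators. -/
  phi : A →ₐ[ℂ] Module.End ℂ E
  phi_adjoint : ∀ a ξ η, inner (phi a ξ) η = inner ξ (phi (star a) η)

namespace CStarCorrespondence

variable {A E O G : Type*} [CStarAlgebra A] [NormedAddCommGroup E] [NormedSpace ℂ E]
  [CStarAlgebra O] [Group G] [TopologicalSpace G] [CompactSpace G]

/-- The rank-one operator `θ_{ξ,η}(ζ) = ξ⟨η, ζ⟩`. -/
def theta (X : CStarCorrespondence A E) (ξ η ζ : E) : E :=
  X.act (MulOpposite.op (X.inner η ζ)) ξ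

/-- `(t, π)` is a covariant representation of `X` on `B`. As `E` is finitely generated, each
`φ(a)` is a finite sum of operators `θ_{ξ,η}`, and `ψ_t(φ(a))` is the corresponding sum of the
elements `ψ_t(θ_{ξ,η}) = t(ξ)t(η)^*`. -/
structure IsCovariantRep {B : Type*} [CStarAlgebra B] (X : CStarCorrespondence A E)
    (t : E →ₗ[ℂ] B) (π : A →⋆ₐ[ℂ] B) : Prop where
  star_mul : ∀ ξ η, star (t ξ) * t η = π (X.inner ξ η)
  map_phi : ∀ a ξ, t (X.phi a ξ) = π a * t ξ
  covariant : ∀ a, (∀ b, X.phi b = 0 → a * b = 0) →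
    ∀ (m : ℕ) (u v : Fin m → E), (∀ ζ, X.phi a ζ = ∑ i, X.theta (u i) (v i) ζ) →
      ∑ i, t (u i) * star (t (v i)) = π a

/-- `O` with `(kE, kA)` is the Pimsner algebra of `X` with its universal covariant
representation. -/
structure IsPimsnerAlgebra.{w, x, y, z} {A : Type x} {E : Type y} {O : Type z}
    [CStarAlgebra A] [NormedAddCommGroup E] [NormedSpace ℂ E] [CStarAlgebra O]
    (X : CStarCorrespondence A E) (kE : E →ₗ[ℂ] O) (kA : A →⋆ₐ[ℂ] O) : Prop where
  isCovariantRep : X.IsCovariantRep kE kA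
  universal : ∀ (B : Type w) [CStarAlgebra B] (t : E →ₗ[ℂ] B) (π : A →⋆ₐ[ℂ] B),
    X.IsCovariantRep t π →
      ∃! Φ : O →⋆ₐ[ℂ] B, (∀ ξ, Φ (kE ξ) = t ξ) ∧ ∀ a, Φ (kA a) = π a

/-- `(E, φ, lam)` is a `G`-equivariant C*-correspondence over `(A, α)`. -/
structure IsEquivariant (X : CStarCorrespondence A E) (α : A →⋆ₐ[ℂ] C(G, A))
    (lam : E →ₗ[ℂ] C(G, E)) : Prop where
  map_act : ∀ ξ a g, lam (X.act (MulOpposite.op a) ξ) g = X.act (MulOpposite.op (α a g)) (lam ξ g)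
  inner_eq : ∀ ξ η g, X.inner (lam ξ g) (lam η g) = α (X.inner ξ η) g
  coassoc : ∀ ξ, tensorId lam (lam ξ) = idTensorComul (lam ξ)
  podles : closure (Submodule.span ℂ {F : C(G, E) | ∃ ξ, ∃ f : C(G, ℂ), F = f • lam ξ} :
    Set C(G, E)) = Set.univ
  map_phi : ∀ a ξ g, lam (X.phi a ξ) g = X.phi (α a g) (lam ξ g)

/-- The action `ρ` of `G` on the Pimsner algebra `(O, kE, kA)` of `X` is a lift: it is the
homomorphism `ω` with `ω ∘ kE = (kE ⊗ id) ∘ lam` and `ω ∘ kA = (kA ⊗ id) ∘ α` induced by an action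
`(α, lam)` of `G` on the correspondence. -/
def IsLift (X : CStarCorrespondence A E) (kE : E →ₗ[ℂ] O) (kA : A →⋆ₐ[ℂ] O)
    (ρ : O →⋆ₐ[ℂ] C(G, O)) : Prop :=
  ∃ (α : A →⋆ₐ[ℂ] C(G, A)) (lam : E →ₗ[ℂ] C(G, E)),
    IsGAction α ∧ X.IsEquivariant α lam ∧
      (∀ ξ, ⇑(ρ (kE ξ)) = kE ∘ lam ξ) ∧ ∀ a, ⇑(ρ (kA a)) = kA ∘ α a

end CStarCorrespondence

/-- `γ` is the gauge action on the Pimsner algebra `(O, kE, kA)`. -/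
def IsGaugeAction {A E O : Type*} [CStarAlgebra A] [NormedAddCommGroup E] [NormedSpace ℂ E]
    [CStarAlgebra O] (kE : E →ₗ[ℂ] O) (kA : A →⋆ₐ[ℂ] O) (γ : Circle →* (O ≃⋆ₐ[ℂ] O)) : Prop :=
  (∀ x, Continuous fun z => γ z x) ∧
    ∀ z, (∀ a, γ z (kA a) = kA a) ∧ ∀ ξ, γ z (kE ξ) = (z : ℂ) • kE ξ

/-- Gauge-equivariance of `ρ`: `(γ_z ⊗ id) ∘ ρ = ρ ∘ γ_z` for all `z ∈ 𝕋`. -/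
def IsGaugeEquivariant {A E O G : Type*} [CStarAlgebra A] [NormedAddCommGroup E] [NormedSpace ℂ E]
    [CStarAlgebra O] [TopologicalSpace G] [CompactSpace G] (kE : E →ₗ[ℂ] O) (kA : A →⋆ₐ[ℂ] O)
    (ρ : O →⋆ₐ[ℂ] C(G, O)) : Prop :=
  ∃ γ : Circle →* (O ≃⋆ₐ[ℂ] O), IsGaugeAction kE kA γ ∧ ∀ z x, γ z ∘ ρ x = ρ (γ z x)

/-! ### Graph correspondences -/

/-- A directed graph, with loops and multiple edges allowed. -/
structure DirectedGraph (V E : Type*) where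
  r : E → V
  s : E → V

/-- `C(𝒢¹)`, the complex functions on the edges, with the Hilbert `C(𝒢⁰)`-module norm. -/
def GraphModule {V E : Type*} (_ : DirectedGraph V E) : Type _ := E → ℂ

namespace GraphModule

variable {V E : Type*} (Q : DirectedGraph V E)

instance : AddCommGroup (GraphModule Q) := inferInstanceAs (AddCommGroup (E → ℂ))

instance : Module ℂ (GraphModule Q) := inferInstanceAs (Module ℂ (E → ℂ))

/-- The value at the edge `e`. -/
def eval (e : E) : GraphModule Q →ₗ[ℂ] ℂ := LinearMap.proj (φ := fun _ : E => ℂ) e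

theorem eval_ext {ξ η : GraphModule Q} (h : ∀ e, eval Q e ξ = eval Q e η) : ξ = η := funext h

/-- The indicator function of the edge `e`. -/
def single [DecidableEq E] (e : E) : GraphModule Q := Pi.single (M := fun _ : E => ℂ) e 1

theorem eval_single [DecidableEq E] (e e' : E) :
    eval Q e (single Q e') = if e = e' then 1 else 0 := Pi.single_apply ..

/-- Restriction to the fibres of `r`; the module norm is the supremum of the Euclidean norms of
the restrictions. -/
noncomputable def fibres : GraphModule Q →ₗ[ℂ] (v : V) → EuclideanSpace ℂ {e : E // Q.r e = v} :=
  LinearMap.pi fun v => (WithLp.linearEquiv 2 ℂ ({e : E // Q.r e = v} → ℂ)).symm.toLinearMap ∘ₗ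
    LinearMap.pi fun e => eval Q e.1

theorem fibres_apply (ξ : GraphModule Q) (v : V) (e : {e : E // Q.r e = v}) :
    fibres Q ξ v e = eval Q e.1 ξ := rfl

theorem fibres_injective : Function.Injective (fibres Q) := fun _ _ h =>
  funext fun e => congrArg (fun F => F (Q.r e) ⟨e, rfl⟩) h

/-- Multiplication of functions on the edges by the functions `f ∘ q`, for `q : E → V`. -/
def mulLeft (q : E → V) : (V → ℂ) →ₐ[ℂ] Module.End ℂ (GraphModule Q) :=
  (Algebra.lmul ℂ (E → ℂ)).comp (AlgHom.pi fun e => Pi.evalAlgHom ℂ (fun _ : V => ℂ) (q e))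

theorem eval_mulLeft (q : E → V) (f : V → ℂ) (ξ : GraphModule Q) (e : E) :
    eval Q e (mulLeft Q q f ξ) = f (q e) * eval Q e ξ := rfl

variable [DecidableEq V] [Fintype E]

/-- `⟨ξ, η⟩(v) = ∑_{r(e) = v} conj(ξ(e)) η(e)`. -/
noncomputable def ip (ξ η : GraphModule Q) : V → ℂ := fun v =>
  ∑ e : {e : E // Q.r e = v}, starRingEnd ℂ (eval Q e.1 ξ) * eval Q e.1 η

theorem ip_self (ξ : GraphModule Q) (v : V) : ip Q ξ ξ v = ((‖fibres Q ξ v‖ : ℝ) : ℂ) ^ 2 := by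
  rw [← Complex.ofReal_pow, EuclideanSpace.norm_sq_eq]
  simp [ip, fibres_apply, Complex.conj_mul']

variable [Fintype V]

noncomputable instance : NormedAddCommGroup (GraphModule Q) :=
  NormedAddCommGroup.induced _ _ (fibres Q) (fibres_injective Q)

noncomputable instance : NormedSpace ℂ (GraphModule Q) :=
  NormedSpace.induced ℂ _ _ (fibres Q)

theorem norm_def (ξ : GraphModule Q) : ‖ξ‖ = ‖fibres Q ξ‖ := rfl

instance : FiniteDimensional ℂ (GraphModule Q) :=
  inferInstanceAs (FiniteDimensional ℂ (E → ℂ))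

end GraphModule

open GraphModule in
/-- The correspondence `(C(𝒢¹), φ)` over `C(𝒢⁰)` of a finite directed graph:
`(ξ · f)(e) = ξ(e) f(r(e))` and `(φ(f)ξ)(e) = f(s(e)) ξ(e)`. -/
noncomputable def graphCorrespondence {V E : Type*} [Fintype V] [DecidableEq V] [Fintype E]
    (Q : DirectedGraph V E) : CStarCorrespondence (V → ℂ) (GraphModule Q) where
  complete := FiniteDimensional.complete ℂ _
  act := (mulLeft Q Q.r).comp (AlgEquiv.toOpposite ℂ (V → ℂ)).symm.toAlgHom
  inner := ip Q
  inner_add_right ξ η ζ := by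
    ext v
    simp [ip, mul_add, Finset.sum_add_distrib]
  inner_act_right ξ η a := by
    ext v
    simp only [ip, Pi.mul_apply, Finset.sum_mul]
    refine Finset.sum_congr rfl fun e _ => ?_
    change _ * eval Q e.1 (mulLeft Q Q.r a η) = _
    rw [eval_mulLeft, e.2]
    ring
  star_inner ξ η := by
    ext v
    simp [ip, mul_comm]
  inner_self_nonneg ξ := by
    refine ⟨fun v => ((‖fibres Q ξ v‖ : ℝ) : ℂ), ?_⟩
    ext v
    simp only [Pi.mul_apply, Pi.star_apply, RCLike.star_def, Complex.conj_ofReal]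
    rw [ip_self, pow_two]
  norm_sq ξ := by
    rw [norm_def, show ip Q ξ ξ = _ from funext fun v => ip_self Q ξ v]
    have h : ∀ v, ‖((‖fibres Q ξ v‖ : ℝ) : ℂ) ^ 2‖ = ‖fibres Q ξ v‖ ^ 2 := fun v => by simp
    refine le_antisymm ?_ ((pi_norm_le_iff_of_nonneg (sq_nonneg _)).2 fun v => ?_)
    · refine (Real.le_sqrt (norm_nonneg _) (norm_nonneg _)).1
        ((pi_norm_le_iff_of_nonneg (Real.sqrt_nonneg _)).2 fun v => Real.le_sqrt_of_sq_le ?_)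
      rw [← h v]
      exact norm_le_pi_norm (fun v => ((‖fibres Q ξ v‖ : ℝ) : ℂ) ^ 2) v
    · rw [h v]
      exact pow_le_pow_left₀ (norm_nonneg _) (norm_le_pi_norm _ v) 2
  exists_frame := by
    classical
    refine ⟨Fintype.card E, fun i => single Q ((Fintype.equivFin E).symm i),
      fun i => single Q ((Fintype.equivFin E).symm i), fun ξ => eval_ext Q fun e => ?_⟩
    rw [map_sum]
    refine Eq.trans ?_ (Equiv.sum_comp (Fintype.equivFin E).symm
      (fun i => eval Q e (mulLeft Q Q.r (ip Q (single Q i) ξ) (single Q i)))).symm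
    simp only [eval_mulLeft, eval_single, mul_ite, mul_one, mul_zero, Finset.sum_ite_eq,
      Finset.mem_univ, if_true]
    rw [ip, Finset.sum_eq_single ⟨e, rfl⟩]
    · simp [eval_single]
    · intro e' _ he'
      rw [eval_single, if_neg fun h => he' (Subtype.ext h), map_zero, zero_mul]
    · simp
  phi := mulLeft Q Q.s
  phi_adjoint a ξ η := by
    ext v
    refine Finset.sum_congr rfl fun e _ => ?_
    rw [eval_mulLeft, eval_mulLeft, map_mul, Pi.star_apply, RCLike.star_def]
    ring

/-! ### The Cuntz algebra as a Pimsner algebra and the action of the torus -/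

/-- The graph with one vertex and `n` loops. -/
def rose (n : ℕ) : DirectedGraph Unit (Fin n) := ⟨fun _ => (), fun _ => ()⟩

namespace CuntzAlgebra

/-- `k_E(ξ) = ∑_i ξ(i) S_i`. -/
noncomputable def kE (n : ℕ) : GraphModule (rose n) →ₗ[ℂ] CuntzAlgebra n :=
  ∑ i, (GraphModule.eval (rose n) i).smulRight (S i)

/-- `k_A(a) = a · 1`. -/
noncomputable def kA (n : ℕ) : (Unit → ℂ) →⋆ₐ[ℂ] CuntzAlgebra n :=
  (StarAlgHom.ofId ℂ (CuntzAlgebra n)).comp (Pi.evalStarAlgHom ℂ (fun _ : Unit => ℂ) ())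

/-- The generator `z_k` of `C(𝕋ⁿ)`. -/
def z {n : ℕ} (k : Fin n) : C(Fin n → Circle, ℂ) := ⟨fun t => (t k : ℂ), by fun_prop⟩

/-- `u = ∑_k S_k S_k^* ⊗ z_k ∈ 𝒪_n ⊗ C(𝕋ⁿ)`. -/
noncomputable def u (n : ℕ) : C(Fin n → Circle, CuntzAlgebra n) :=
  ∑ k, tmul (S k * star (S k)) (z k)

end CuntzAlgebra

/-- `ρ` is linear: `ρ(S_j) = ∑_i S_i ⊗ q_{ij}` for some `q_{ij} ∈ C(G)`. -/
def IsLinearAction {n : ℕ} {G : Type*} [TopologicalSpace G] [CompactSpace G]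
    (ρ : CuntzAlgebra n →⋆ₐ[ℂ] C(G, CuntzAlgebra n)) : Prop :=
  ∃ q : Fin n → Fin n → C(G, ℂ), ∀ j, ρ (CuntzAlgebra.S j) = ∑ i, tmul (CuntzAlgebra.S i) (q i j)

universe w

/-! ### The universal property of the Cuntz algebra -/

/-! A unital `*`-homomorphism out of `𝒪_n` is the same as a Cuntz family in the target (`lift`,
`hom_ext`), so every map is built, and every identity between maps checked, on the generators alone.

Right multiplication by a unitary preserves the Cuntz relations (`mul_right`), and `u_t = ∑ t_k S_k
S_k^*` is a unitary representation of the torus; hence `ρ_t(S_i) = S_i u_t` defines `ρ`. Since `u_t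
u_t^* = 1`, `ρ_t` fixes each `S_k S_k^*`, hence each `u_s` (`torusAction_u`), so `ρ_s(ρ_t(S_i)) =
S_i u_s u_t = ρ_{st}(S_i)`. Density follows because `F ↦ (t ↦ ρ_t(F(t)))` is a continuous surjection
taking `a ⊗ f` to `ρ(a)(1 ⊗ f)`. The gauge automorphisms also fix `u_t`, whence equivariance.

If `ρ` were linear, multiplying `ρ(S_a)` by `S_a^*` would make every `u_t` scalar. But `u_t S_i =
t_i S_i`, which forces all `t_i` to agree; with two coordinates and `𝒪_n ≠ 0` this is absurd. A lift
maps each `S_j = k_E(e_j)` into the combinations of the `S_i`, so it would be linear. For the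
Pimsner property, covariant representations of the rose correspond to Cuntz families: the inner
product gives orthonormality, and covariance at `a = 1` gives completeness. -/

/-- The Cuntz relations for a family `T` in a unital `*`-ring. -/
structure IsCuntzFamily {n : ℕ} {B : Type*} [Ring B] [StarRing B] (T : Fin n → B) : Prop where
  orthonormal : ∀ i j, star (T i) * T j = if i = j then 1 else 0
  complete : ∑ i, T i * star (T i) = 1

namespace FreeStarAlgebra

variable {n : ℕ} {B : Type*} [CStarAlgebra B]

/-- The `*`-homomorphism on the free `*`-algebra that sends the generators to `T`. -/
noncomputable def lift (T : Fin n → B) : FreeStarAlgebra n →ₐ[ℂ] B :=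
  MonoidAlgebra.lift ℂ B (FreeMonoid (Fin n × Bool))
    (FreeMonoid.lift fun x => if x.2 then star (T x.1) else T x.1)

theorem lift_letter (T : Fin n → B) (x : Fin n × Bool) :
    lift T (letter x) = if x.2 then star (T x.1) else T x.1 := by
  simp [lift, letter]

theorem lift_gen (T : Fin n → B) (i : Fin n) : lift T (gen i) = T i := by
  simp [gen, lift_letter]

theorem lift_star (T : Fin n → B) (x : FreeStarAlgebra n) :
    lift T (star x) = star (lift T x) := by
  induction x using MonoidAlgebra.induction_on with
  | of w =>
    induction w using FreeMonoid.inductionOn' with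
    | one => simp only [map_one, star_one]
    | of_mul x w ih =>
      rw [map_mul, star_mul, map_mul, ih, map_mul, star_mul]
      congr 1
      change lift T (star (letter x)) = star (lift T (letter x))
      rw [star_letter, lift_letter, lift_letter]
      rcases x with ⟨i, _ | _⟩ <;> simp
  | add x y hx hy => rw [star_add, map_add, hx, hy, map_add, star_add]
  | smul c x hx => rw [star_smul, map_smul, hx, map_smul, star_smul]

/-- The norm of `B` pulled back along `lift T` is one of the seminorms whose supremum defines the
norm of the free `*`-algebra. -/
theorem norm_lift_le {T : Fin n → B} (hT : IsCuntzFamily T) (x : FreeStarAlgebra n) :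
    ‖lift T x‖ ≤ ‖x‖ := by
  have hp : IsCuntzSeminorm ((normSeminorm ℂ B).comp (lift T).toLinearMap) :=
    { mul_le := fun x y => by simpa using norm_mul_le (lift T x) (lift T y)
      star_mul_self := fun x => by
        simp [lift_star, CStarRing.norm_star_mul_self, pow_two]
      orthonormal := fun i j => by
        have : lift T (star (gen i) * gen j - if i = j then 1 else 0) = 0 := by
          rw [map_sub, map_mul, lift_star, lift_gen, lift_gen, hT.orthonormal]
          split_ifs <;> simp
        simp only [Seminorm.comp_apply, AlgHom.toLinearMap_apply, this, map_zero]
      complete := by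
        have : lift T (∑ i, gen i * star (gen i) - 1) = 0 := by
          simp [lift_star, lift_gen, hT.complete]
        simp only [Seminorm.comp_apply, AlgHom.toLinearMap_apply, this, map_zero] }
  exact le_cuntzNorm hp x

theorem continuous_lift {T : Fin n → B} (hT : IsCuntzFamily T) : Continuous (lift T) :=
  AddMonoidHomClass.continuous_of_bound (lift T) 1 fun x => by
    simpa using norm_lift_le hT x

end FreeStarAlgebra

namespace CuntzAlgebra

open UniformSpace FreeStarAlgebra

variable {n : ℕ} {B : Type*} [CStarAlgebra B]

/-- The `*`-homomorphism on `𝒪_n` that sends the generators to a given Cuntz family. -/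
noncomputable def lift (T : Fin n → B) (hT : IsCuntzFamily T) : CuntzAlgebra n →⋆ₐ[ℂ] B where
  __ := Completion.extensionHom (FreeStarAlgebra.lift T).toRingHom (continuous_lift hT)
  commutes' c := by
    change Completion.extensionHom (FreeStarAlgebra.lift T).toRingHom (continuous_lift hT)
      ((algebraMap ℂ (FreeStarAlgebra n) c : FreeStarAlgebra n) : CuntzAlgebra n) = _
    rw [Completion.extensionHom_coe]
    exact (FreeStarAlgebra.lift T).commutes c
  map_star' x := by
    change Completion.extensionHom (FreeStarAlgebra.lift T).toRingHom (continuous_lift hT) _ =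
      star (Completion.extensionHom (FreeStarAlgebra.lift T).toRingHom (continuous_lift hT) _)
    have hc : Continuous
        (Completion.extensionHom (FreeStarAlgebra.lift T).toRingHom (continuous_lift hT)) :=
      Completion.continuous_extension
    induction x using Completion.induction_on with
    | hp => exact isClosed_eq (hc.comp continuous_star') (continuous_star.comp hc)
    | ih x =>
      rw [← coe_star, Completion.extensionHom_coe, Completion.extensionHom_coe]
      exact FreeStarAlgebra.lift_star T x

theorem lift_S {T : Fin n → B} (hT : IsCuntzFamily T) (i : Fin n) : lift T hT (S i) = T i :=
  (Completion.extensionHom_coe (FreeStarAlgebra.lift T).toRingHom (continuous_lift hT) _).trans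
    (FreeStarAlgebra.lift_gen T i)

theorem isCuntzFamily_S : IsCuntzFamily (S : Fin n → CuntzAlgebra n) where
  orthonormal i j := by
    have h : ‖star (gen i : FreeStarAlgebra n) * gen j - if i = j then 1 else 0‖ = 0 :=
      le_antisymm (ciSup_le fun p => (p.2.orthonormal i j).le) (cuntzNorm_nonneg _)
    rw [← Completion.norm_coe, norm_eq_zero, Completion.coe_sub, Completion.coe_mul, coe_star,
      sub_eq_zero] at h
    rw [S, S, h]
    split_ifs
    · exact Completion.coe_one _
    · exact Completion.coe_zero
  complete := by
    have h : ‖∑ i, (gen i : FreeStarAlgebra n) * star (gen i) - 1‖ = 0 :=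
      le_antisymm (ciSup_le fun p => p.2.complete.le) (cuntzNorm_nonneg _)
    rw [← Completion.norm_coe, norm_eq_zero, Completion.coe_sub, sub_eq_zero,
      Completion.coe_one] at h
    rw [← h]
    change _ = Completion.coeRingHom (∑ i, (gen i : FreeStarAlgebra n) * star (gen i))
    rw [map_sum]
    refine Finset.sum_congr rfl fun i _ => ?_
    rw [map_mul, S, ← coe_star]
    rfl

/-- A closed unital `*`-subalgebra that contains the generators is everything. -/
theorem mem_of_isClosed (D : StarSubalgebra ℂ (CuntzAlgebra n))
    (hD : IsClosed (D : Set (CuntzAlgebra n))) (h : ∀ i, S i ∈ D) (x : CuntzAlgebra n) :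
    x ∈ D := by
  induction x using Completion.induction_on with
  | hp => exact hD
  | ih x =>
    induction x using MonoidAlgebra.induction_on with
    | of w =>
      induction w using FreeMonoid.inductionOn' with
      | one => rw [map_one, Completion.coe_one]; exact one_mem D
      | of_mul x w ih =>
        rw [map_mul, Completion.coe_mul]
        refine mul_mem ?_ ih
        obtain ⟨i, _ | _⟩ := x
        · exact h i
        · have := star_mem (h i)
          rw [S, ← coe_star, gen, star_letter] at this
          exact this
    | add x y hx hy => rw [Completion.coe_add]; exact add_mem hx hy
    | smul c x hx => rw [Completion.coe_smul]; exact D.smul_mem hx c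

theorem continuous_starAlgHom (φ : CuntzAlgebra n →⋆ₐ[ℂ] B) : Continuous φ :=
  AddMonoidHomClass.continuous_of_bound φ 1 fun x => by
    simpa using NonUnitalStarAlgHom.norm_apply_le φ x

/-- The equalizer is a closed unital `*`-subalgebra, as `*`-homomorphisms are continuous. -/
theorem hom_ext {φ ψ : CuntzAlgebra n →⋆ₐ[ℂ] B} (h : ∀ i, φ (S i) = ψ (S i)) : φ = ψ := by
  refine StarAlgHom.ext fun x => ?_
  refine mem_of_isClosed (StarAlgHom.equalizer φ ψ) ?_ h x
  exact isClosed_eq (continuous_starAlgHom φ) (continuous_starAlgHom ψ)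

end CuntzAlgebra

/-! ### Nontriviality of the Cuntz algebra -/

namespace CuntzAlgebra

open scoped InnerProductSpace

/-- The isometry of `ℓ²(ι)` that permutes the standard basis vectors along an injection. -/
theorem exists_isometry_single {ι : Type*} [DecidableEq ι] (f : ι ↪ ι) :
    ∃ V : lp (fun _ : ι => ℂ) 2 →ₗᵢ[ℂ] lp (fun _ : ι => ℂ) 2,
      ∀ i, V (lp.single 2 i 1) = lp.single 2 (f i) 1 := by
  have ho : Orthonormal ℂ fun i : ι => (lp.single 2 (f i) (1 : ℂ) : lp (fun _ : ι => ℂ) 2) := by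
    rw [orthonormal_iff_ite]
    intro i j
    rw [lp.inner_single_left, lp.single_apply]
    by_cases h : i = j
    · subst h; simp
    · simp [h]
  exact ⟨ho.orthogonalFamily.linearIsometry, fun i => by
    rw [OrthogonalFamily.linearIsometry_apply_single]; simp⟩

/-- Every `x` is the norm-convergent sum of its components `x i • e_i`, because the exponent 2 is
finite. -/
theorem clm_ext_single {ι : Type*} [DecidableEq ι] {F : Type*} [NormedAddCommGroup F]
    [NormedSpace ℂ F]
    {T R : lp (fun _ : ι => ℂ) 2 →L[ℂ] F}
    (h : ∀ i, T (lp.single 2 i 1) = R (lp.single 2 i 1)) : T = R := by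
  refine ContinuousLinearMap.ext fun x => ?_
  have hx := lp.hasSum_single (p := 2) ENNReal.ofNat_ne_top x
  refine (T.hasSum hx).unique ?_
  convert R.hasSum hx using 2 with i
  have : (lp.single 2 i (x i) : lp (fun _ : ι => ℂ) 2) = x i • lp.single 2 i 1 := by
    rw [← lp.single_smul]; simp
  rw [this, map_smul, map_smul, h]

/-- A Cuntz family of `n ≥ 1` isometries on `ℓ²(ℕ)`. -/
theorem exists_isCuntzFamily (n : ℕ) [NeZero n] :
    ∃ T : Fin n → (lp (fun _ : ℕ => ℂ) 2 →L[ℂ] lp (fun _ : ℕ => ℂ) 2), IsCuntzFamily T := by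
  -- Division with remainder: `e (m, i) = m * n + i`. The isometry `V i` sends `e_m` to `e_{mn+i}`,
  -- so the ranges split the basis by residue modulo `n`.
  let e : ℕ × Fin n ≃ ℕ := Nat.divModEquiv n |>.symm
  choose V hV using fun i : Fin n => exists_isometry_single
    (ι := ℕ) ⟨fun m => e (m, i), fun a b h => by simpa using h⟩
  have hV' : ∀ i m, V i (lp.single 2 m 1) = lp.single 2 (e (m, i)) 1 := hV
  -- The adjoint of `V i` undoes `V i` on the residue class of `i` and kills the other basis
  -- vectors; this is read off coordinate by coordinate, the `k`-th coordinate being the inner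
  -- product with `e_k`.
  have hadj : ∀ i j m, star (V i).toContinuousLinearMap (lp.single 2 (e (m, j)) 1) =
      if i = j then lp.single 2 m 1 else (0 : lp (fun _ : ℕ => ℂ) 2) := by
    intro i j m
    ext k
    have h1 : ∀ y : lp (fun _ : ℕ => ℂ) 2, y k = ⟪lp.single 2 k (1 : ℂ), y⟫_ℂ := fun y => by
      rw [lp.inner_single_left]; simp
    rw [h1, ContinuousLinearMap.star_eq_adjoint, ContinuousLinearMap.adjoint_inner_right,
      LinearIsometry.coe_toContinuousLinearMap, hV', lp.inner_single_left]
    split_ifs with hij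
    · subst hij
      simp [lp.single_apply, Pi.single_apply]
    · simp [lp.single_apply, hij]
  refine ⟨fun i => (V i).toContinuousLinearMap, ⟨fun i j => clm_ext_single fun m => ?_,
    clm_ext_single fun m => ?_⟩⟩
  · change star (V i).toContinuousLinearMap (V j (lp.single 2 m 1)) = _
    rw [hV', hadj]
    split_ifs <;> simp
  · obtain ⟨⟨m, j⟩, rfl⟩ := e.surjective m
    rw [sum_apply]
    change ∑ i, V i (star (V i).toContinuousLinearMap (lp.single 2 (e (m, j)) 1)) = _
    simp only [hadj]
    rw [Finset.sum_eq_single j]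
    · simp [hV']
    · intro i _ hij
      simp [hij]
    · simp

/-- The zero seminorm is always admissible in the definition of the norm, so `𝒪_n ≠ 0` needs an
actual representation on a nonzero Hilbert space. -/
instance nontrivial (n : ℕ) [NeZero n] : Nontrivial (CuntzAlgebra n) := by
  obtain ⟨T, hT⟩ := exists_isCuntzFamily n
  let _ : CStarAlgebra (lp (fun _ : ℕ => ℂ) 2 →L[ℂ] lp (fun _ : ℕ => ℂ) 2) := {}
  have : Nontrivial (lp (fun _ : ℕ => ℂ) 2) :=
    ⟨⟨lp.single 2 0 1, 0, fun h => by simpa using congrArg (fun x => x 0) h⟩⟩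
  exact (lift T hT).toRingHom.domain_nontrivial

end CuntzAlgebra

/-! ### Elementary tensors -/

section Tmul

variable {X E : Type*} [TopologicalSpace X] [NormedAddCommGroup E] [NormedSpace ℂ E]

theorem tmul_apply (a : E) (f : C(X, ℂ)) (x : X) : tmul a f x = f x • a := rfl

/-- The elementary tensors span a dense subspace of `C(X, E)`. -/
theorem mem_closure_span_tmul [CompactSpace X] [T2Space X] (F : C(X, E)) :
    F ∈ closure (Submodule.span ℂ {F : C(X, E) | ∃ a f, F = tmul a f} : Set C(X, E)) := by
  rw [Metric.mem_closure_iff]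
  intro ε hε
  -- Finitely many open sets, on each of which `F` stays within `ε / 2` of one of its values, cover
  -- `X`; a subordinate partition of unity glues these values together.
  obtain ⟨t, ht⟩ := isCompact_univ.elim_finite_subcover
    (fun x : X => F ⁻¹' Metric.ball (F x) (ε / 2))
    (fun x => Metric.isOpen_ball.preimage F.continuous)
    (fun x _ => Set.mem_iUnion.2 ⟨x, Metric.mem_ball_self (half_pos hε)⟩)
  obtain ⟨p, hp⟩ := PartitionOfUnity.exists_isSubordinate isClosed_univ
    (fun x : t => F ⁻¹' Metric.ball (F x) (ε / 2))
    (fun x => Metric.isOpen_ball.preimage F.continuous)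
    (fun x hx => by simpa using ht hx)
  refine ⟨∑ x : t, tmul (F x) ((Complex.ofRealCLM : C(ℝ, ℂ)).comp (p x)),
    sum_mem fun x _ => Submodule.subset_span ⟨_, _, rfl⟩, ?_⟩
  refine lt_of_le_of_lt ?_ (half_lt_self hε)
  rw [ContinuousMap.dist_le (half_pos hε).le]
  intro y
  -- At `y` the approximant is a convex combination of values `F x` within `ε / 2` of `F y`, and
  -- balls are convex.
  have hmem : (∑ᶠ x, p x y • F x) ∈ Metric.closedBall (F y) (ε / 2) :=
    p.finsum_smul_mem_convex (g := fun x _ => F x) (Set.mem_univ y) (fun x hx => by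
      have : y ∈ F ⁻¹' Metric.ball (F x) (ε / 2) := hp x (subset_tsupport _ hx)
      exact Metric.mem_closedBall'.2 (Metric.mem_ball.1 this).le)
      (convex_closedBall _ _)
  rw [finsum_eq_sum_of_fintype, Metric.mem_closedBall'] at hmem
  simpa [tmul_apply] using hmem

end Tmul

/-- Evaluation at a point, as a unital `*`-homomorphism on `B ⊗ C(X) = C(X, B)`. -/
def evalPoint {X B : Type*} [TopologicalSpace X] [CStarAlgebra B] (x : X) :
    C(X, B) →⋆ₐ[ℂ] B where
  toFun F := F x
  map_zero' := rfl
  map_one' := rfl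
  map_add' _ _ := rfl
  map_mul' _ _ := rfl
  commutes' _ := rfl
  map_star' _ := rfl

/-! ### The action of the torus -/

namespace IsCuntzFamily

variable {n : ℕ} {B X : Type*}

/-- In `(T_i w)^* (T_j w)` the relation for `T` leaves `w^* w`, and in `T_i w (T_i w)^*` the factor
`w w^*` cancels. -/
theorem mul_right [Ring B] [StarRing B] {T : Fin n → B} (hT : IsCuntzFamily T) {w : B}
    (hw : w ∈ unitary B) : IsCuntzFamily fun i => T i * w where
  orthonormal i j := by
    rw [star_mul, mul_assoc, ← mul_assoc (star (T i)), hT.orthonormal]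
    split_ifs <;> simp [Unitary.star_mul_self_of_mem hw]
  complete := by
    rw [← hT.complete]
    refine Finset.sum_congr rfl fun i _ => ?_
    rw [star_mul, mul_assoc, ← mul_assoc w, Unitary.mul_star_self_of_mem hw, one_mul]

theorem of_apply [TopologicalSpace X] [CStarAlgebra B] {T : Fin n → C(X, B)}
    (h : ∀ x, IsCuntzFamily fun i => T i x) : IsCuntzFamily T where
  orthonormal i j := by
    ext x
    have := (h x).orthonormal i j
    split_ifs with hij
    · simpa [hij] using this
    · simpa [hij] using this
  complete := by
    ext x
    simpa using (h x).complete

end IsCuntzFamily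

namespace CuntzAlgebra

variable {n : ℕ}

theorem star_S_mul_S (i j : Fin n) : star (S i) * S j = if i = j then 1 else 0 :=
  isCuntzFamily_S.orthonormal i j

theorem sum_S_mul_star_S : ∑ i : Fin n, S i * star (S i) = 1 := isCuntzFamily_S.complete

theorem u_apply (t : Fin n → Circle) : u n t = ∑ k, (t k : ℂ) • (S k * star (S k)) := by
  simp [u, tmul_apply, z]

/-- The `S_k S_k^*` are spectral projections of `u_t`, and `S_i` has its range in the `i`-th one. -/
theorem u_apply_mul_S (t : Fin n → Circle) (i : Fin n) : u n t * S i = (t i : ℂ) • S i := by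
  rw [u_apply, Finset.sum_mul, Finset.sum_eq_single i]
  · rw [smul_mul_assoc, mul_assoc, star_S_mul_S, if_pos rfl, mul_one]
  · intro k _ hk
    rw [smul_mul_assoc, mul_assoc, star_S_mul_S, if_neg hk, mul_zero, smul_zero]
  · simp

theorem u_apply_mul (s t : Fin n → Circle) : u n s * u n t = u n (s * t) := by
  rw [u_apply t, Finset.mul_sum, u_apply (s * t)]
  refine Finset.sum_congr rfl fun k _ => ?_
  rw [mul_smul_comm, ← mul_assoc, u_apply_mul_S, smul_mul_assoc, smul_smul, Pi.mul_apply,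
    Circle.coe_mul, mul_comm]

theorem u_apply_one : u n 1 = 1 := by
  simp [u_apply, sum_S_mul_star_S]

theorem star_u_apply (t : Fin n → Circle) : star (u n t) = u n t⁻¹ := by
  simp only [u_apply, star_sum, star_smul, star_mul, star_star, Pi.inv_apply,
    Circle.coe_inv_eq_conj, starRingEnd_apply]

theorem u_apply_mem_unitary (t : Fin n → Circle) : u n t ∈ unitary (CuntzAlgebra n) := by
  rw [Unitary.mem_iff, star_u_apply, u_apply_mul, u_apply_mul]
  simp [u_apply_one]

theorem tmul_one_mul_u_apply (i : Fin n) (t : Fin n → Circle) :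
    (tmul (S i) 1 * u n : C(Fin n → Circle, CuntzAlgebra n)) t = S i * u n t := by
  simp [tmul_apply]

/-- The action `ρ` of the torus, with `ρ(S_i) = (S_i ⊗ 1)u`. -/
noncomputable def torusAction (n : ℕ) : CuntzAlgebra n →⋆ₐ[ℂ] C(Fin n → Circle, CuntzAlgebra n) :=
  lift (fun i => tmul (S i) 1 * u n) <| IsCuntzFamily.of_apply fun t => by
    simp only [tmul_one_mul_u_apply]
    exact isCuntzFamily_S.mul_right (u_apply_mem_unitary t)

theorem torusAction_S (i : Fin n) : torusAction n (S i) = tmul (S i) 1 * u n := lift_S _ i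

theorem torusAction_S_apply (i : Fin n) (t : Fin n → Circle) :
    torusAction n (S i) t = S i * u n t := by
  rw [torusAction_S, tmul_one_mul_u_apply]

/-- In `ρ_t(S_k S_k^*) = S_k u_t u_t^* S_k^*` the unitary cancels. -/
theorem torusAction_u (s t : Fin n → Circle) : torusAction n (u n s) t = u n s := by
  rw [u_apply]
  simp only [map_sum, map_smul, map_mul, map_star, ContinuousMap.sum_apply,
    ContinuousMap.smul_apply, ContinuousMap.mul_apply, ContinuousMap.star_apply,
    torusAction_S_apply]
  refine Finset.sum_congr rfl fun k _ => ?_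
  rw [star_mul, mul_assoc, ← mul_assoc (u n t), Unitary.mul_star_self_of_mem (u_apply_mem_unitary t),
    one_mul]

/-- On generators, `S_i u_t` goes to `S_i u_s u_t` because `ρ_s` fixes `u_t`. -/
theorem torusAction_torusAction (s t : Fin n → Circle) (x : CuntzAlgebra n) :
    torusAction n (torusAction n x t) s = torusAction n x (s * t) := by
  let ev := fun t : Fin n → Circle => evalPoint (B := CuntzAlgebra n) t
  have h : ((ev s).comp (torusAction n)).comp ((ev t).comp (torusAction n)) =
      (ev (s * t)).comp (torusAction n) := hom_ext fun i => by
    change torusAction n (torusAction n (S i) t) s = torusAction n (S i) (s * t)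
    rw [torusAction_S_apply, torusAction_S_apply, map_mul, ContinuousMap.mul_apply,
      torusAction_S_apply, torusAction_u, mul_assoc, u_apply_mul]
  exact DFunLike.congr_fun h x

theorem torusAction_one (x : CuntzAlgebra n) : torusAction n x 1 = x := by
  have h : (evalPoint 1).comp (torusAction n) =
      StarAlgHom.id ℂ (CuntzAlgebra n) := hom_ext fun i => by
    change torusAction n (S i) 1 = S i
    rw [torusAction_S_apply, u_apply_one, mul_one]
  exact DFunLike.congr_fun h x

/-- The map `F ↦ (t ↦ ρ_t(F(t)))` on `𝒪_n ⊗ C(𝕋ⁿ)`. -/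
noncomputable def torusTwist (n : ℕ) :
    C(Fin n → Circle, CuntzAlgebra n) →ₗ[ℂ] C(Fin n → Circle, CuntzAlgebra n) where
  toFun F := ⟨fun t => torusAction n (F t) t,
    continuous_eval.comp (((continuous_starAlgHom (torusAction n)).comp F.continuous).prodMk
      continuous_id)⟩
  map_add' F H := by ext; simp
  map_smul' c F := by ext; simp

theorem torusTwist_apply (F : C(Fin n → Circle, CuntzAlgebra n)) (t : Fin n → Circle) :
    torusTwist n F t = torusAction n (F t) t := rfl

theorem continuous_torusTwist : Continuous (torusTwist n) :=
  ContinuousMap.continuous_of_continuous_uncurry _ <|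
    continuous_eval.comp (((continuous_starAlgHom (torusAction n)).comp continuous_eval).prodMk
      continuous_snd)

theorem torusTwist_surjective : Function.Surjective (torusTwist n) := fun F => by
  refine ⟨⟨fun t => torusAction n (F t) t⁻¹,
    continuous_eval.comp (((continuous_starAlgHom (torusAction n)).comp F.continuous).prodMk
      continuous_inv)⟩, ?_⟩
  ext t
  rw [torusTwist_apply]
  change torusAction n (torusAction n (F t) t⁻¹) t = F t
  rw [torusAction_torusAction, mul_inv_cancel, torusAction_one]

theorem torusTwist_tmul (a : CuntzAlgebra n) (f : C(Fin n → Circle, ℂ)) :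
    torusTwist n (tmul a f) = torusAction n a * tmul 1 f := by
  ext t
  simp [torusTwist_apply, tmul_apply]

theorem isGAction_torusAction : IsGAction (torusAction n) where
  coassoc a := funext fun p => torusAction_torusAction p.1 p.2 a
  podles := Set.eq_univ_of_forall fun F => by
    -- The twist is continuous and onto, so it carries the dense span of the elementary tensors onto
    -- a dense subspace.
    obtain ⟨F, rfl⟩ := torusTwist_surjective F
    refine map_mem_closure continuous_torusTwist (mem_closure_span_tmul F) fun H hH => ?_
    refine Submodule.span_le (p := (Submodule.span ℂ _).comap (torusTwist n)).2 ?_ hH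
    rintro _ ⟨a, f, rfl⟩
    exact Submodule.subset_span ⟨a, f, torusTwist_tmul a f⟩

/-! ### The gauge action -/

theorem star_coe_mul_coe (z : Circle) : star (z : ℂ) * z = 1 := by
  rw [← starRingEnd_apply, ← Circle.coe_inv_eq_conj, ← Circle.coe_mul, inv_mul_cancel,
    Circle.coe_one]

theorem coe_mul_star_coe (z : Circle) : (z : ℂ) * star (z : ℂ) = 1 := by
  rw [mul_comm, star_coe_mul_coe]

/-- The coaction form of the gauge action, sending `x` to `z ↦ γ_z(x)`. -/
noncomputable def gaugeCoaction (n : ℕ) : CuntzAlgebra n →⋆ₐ[ℂ] C(Circle, CuntzAlgebra n) :=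
  lift (fun i => tmul (S i) ⟨fun z => (z : ℂ), by fun_prop⟩) <| IsCuntzFamily.of_apply fun z => by
    change IsCuntzFamily fun i : Fin n => (z : ℂ) • S i
    constructor
    · intro i j
      rw [star_smul, smul_mul_smul_comm, star_coe_mul_coe, one_smul, star_S_mul_S]
    · simp only [star_smul, smul_mul_smul_comm, coe_mul_star_coe, one_smul, sum_S_mul_star_S]

theorem gaugeCoaction_S_apply (i : Fin n) (z : Circle) :
    gaugeCoaction n (S i) z = (z : ℂ) • S i := by
  rw [gaugeCoaction, lift_S]; rfl

/-- The endomorphism `γ_z`. -/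
noncomputable def gaugeHom (n : ℕ) (z : Circle) : CuntzAlgebra n →⋆ₐ[ℂ] CuntzAlgebra n :=
  (evalPoint z).comp (gaugeCoaction n)

theorem gaugeHom_S (z : Circle) (i : Fin n) : gaugeHom n z (S i) = (z : ℂ) • S i :=
  gaugeCoaction_S_apply i z

theorem gaugeHom_one : gaugeHom n 1 = StarAlgHom.id ℂ _ := hom_ext fun i => by
  simp [gaugeHom_S]

theorem gaugeHom_mul (z w : Circle) : gaugeHom n (z * w) = (gaugeHom n z).comp (gaugeHom n w) :=
  hom_ext fun i => by
    simp [gaugeHom_S, smul_smul, mul_comm]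

/-- The gauge action of the circle on `𝒪_n`. -/
noncomputable def gaugeAction (n : ℕ) : Circle →* (CuntzAlgebra n ≃⋆ₐ[ℂ] CuntzAlgebra n) where
  toFun z := StarAlgEquiv.ofStarAlgHom (gaugeHom n z) (gaugeHom n z⁻¹)
    (by rw [← gaugeHom_mul, inv_mul_cancel, gaugeHom_one])
    (by rw [← gaugeHom_mul, mul_inv_cancel, gaugeHom_one])
  map_one' := StarAlgEquiv.ext fun x => DFunLike.congr_fun gaugeHom_one x
  map_mul' z w := StarAlgEquiv.ext fun x => DFunLike.congr_fun (gaugeHom_mul z w) x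

theorem gaugeAction_apply (z : Circle) (x : CuntzAlgebra n) :
    gaugeAction n z x = gaugeHom n z x := rfl

theorem kE_apply (ξ : GraphModule (rose n)) :
    kE n ξ = ∑ i, GraphModule.eval (rose n) i ξ • S i := by
  simp [kE]

theorem kA_apply (a : Unit → ℂ) : kA n a = algebraMap ℂ _ (a ()) := rfl

theorem isGaugeAction_gaugeAction : IsGaugeAction (kE n) (kA n) (gaugeAction n) := by
  -- Strong continuity comes for free: `z ↦ γ_z(x)` is by construction an element of `C(𝕋, 𝒪_n)`.
  refine ⟨fun x => (gaugeCoaction n x).continuous, fun z => ⟨fun a => ?_, fun ξ => ?_⟩⟩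
  · rw [gaugeAction_apply, kA_apply]
    exact AlgHomClass.commutes (gaugeHom n z) _
  · simp [gaugeAction_apply, kE_apply, gaugeHom_S, Finset.smul_sum, smul_smul, mul_comm]

/-- In each `S_k S_k^*` the scalars `z` and its conjugate cancel. -/
theorem gaugeHom_u (z : Circle) (t : Fin n → Circle) : gaugeHom n z (u n t) = u n t := by
  simp only [u_apply, map_sum, map_smul, map_mul, map_star, gaugeHom_S, star_smul,
    smul_mul_smul_comm, coe_mul_star_coe, one_smul]

theorem isGaugeEquivariant_torusAction : IsGaugeEquivariant (kE n) (kA n) (torusAction n) := by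
  refine ⟨gaugeAction n, isGaugeAction_gaugeAction, fun z x => funext fun t => ?_⟩
  let ev := evalPoint (B := CuntzAlgebra n) t
  have h : (gaugeHom n z).comp (ev.comp (torusAction n)) =
      (ev.comp (torusAction n)).comp (gaugeHom n z) := hom_ext fun i => by
    change gaugeHom n z (torusAction n (S i) t) = torusAction n (gaugeHom n z (S i)) t
    rw [torusAction_S_apply, map_mul, gaugeHom_S, gaugeHom_u, map_smul, ContinuousMap.smul_apply,
      torusAction_S_apply, smul_mul_assoc]
  exact DFunLike.congr_fun h x

/-! ### Non-linearity -/

theorem not_isLinearAction_torusAction (hn : 2 ≤ n) : ¬ IsLinearAction (torusAction n) := by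
  rintro ⟨q, hq⟩
  have : NeZero n := ⟨by omega⟩
  let a : Fin n := ⟨0, by omega⟩
  let b : Fin n := ⟨1, by omega⟩
  have hab : a ≠ b := by simp [a, b]
  -- Any point with `t a ≠ t b` would do.
  let t : Fin n → Circle := fun k => if k = a then 1 else -1
  have hu : u n t = q a a t • (1 : CuntzAlgebra n) := by
    have h := congrArg (fun x => star (S a) * x) (DFunLike.congr_fun (hq a) t)
    simp only [torusAction_S_apply, ContinuousMap.sum_apply, tmul_apply] at h
    rw [← mul_assoc, star_S_mul_S, if_pos rfl, one_mul] at h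
    simpa [Finset.mul_sum, star_S_mul_S] using h
  -- Compressing by `S_i` gives `S_i^* u_t S_i = t_i`, which for a scalar `u_t` does not depend on
  -- `i`. Comparing the coefficients of `1` needs `𝒪_n ≠ 0`.
  have key : ∀ i, (t i : ℂ) = q a a t := fun i => by
    have h := congrArg (fun x => star (S i) * x) (u_apply_mul_S t i)
    simp only [hu, smul_mul_assoc, one_mul, mul_smul_comm, star_S_mul_S, if_true] at h
    exact (smul_left_injective ℂ (one_ne_zero (α := CuntzAlgebra n)) h).symm
  have h := (key a).trans (key b).symm
  simp [t, hab.symm] at h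
  norm_num at h

/-- Take for `q_{ij}` the `i`-th coordinate of `lam(e_j)`, continuous because `E` is
finite-dimensional; the relation `ρ ∘ k_E = (k_E ⊗ id) ∘ lam` at `e_j` is then linearity. -/
theorem isLinearAction_of_isLift {ρ : CuntzAlgebra n →⋆ₐ[ℂ] C(Fin n → Circle, CuntzAlgebra n)}
    (h : (graphCorrespondence (rose n)).IsLift (kE n) (kA n) ρ) : IsLinearAction ρ := by
  obtain ⟨α, lam, -, -, h, -⟩ := h
  refine ⟨fun i j => ⟨fun t => GraphModule.eval (rose n) i (lam (GraphModule.single (rose n) j) t),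
    (LinearMap.continuous_of_finiteDimensional (GraphModule.eval (rose n) i)).comp
      (lam _).continuous⟩, fun j => ?_⟩
  have hj := h (GraphModule.single (rose n) j)
  rw [kE_apply] at hj
  simp only [GraphModule.eval_single, ite_smul, one_smul, zero_smul, Finset.sum_ite_eq',
    Finset.mem_univ, if_true] at hj
  ext t
  rw [hj, Function.comp_apply, kE_apply]
  simp [tmul_apply]

/-! ### The Cuntz algebra as a Pimsner algebra -/

theorem ip_rose (ξ η : GraphModule (rose n)) (v : Unit) :
    GraphModule.ip (rose n) ξ η v =
      ∑ i, starRingEnd ℂ (GraphModule.eval (rose n) i ξ) * GraphModule.eval (rose n) i η :=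
  Fintype.sum_equiv (Equiv.subtypeUnivEquiv fun _ => rfl) _ _ fun _ => rfl

theorem eval_theta (ξ η ζ : GraphModule (rose n)) (i : Fin n) :
    GraphModule.eval (rose n) i ((graphCorrespondence (rose n)).theta ξ η ζ) =
      GraphModule.ip (rose n) η ζ () * GraphModule.eval (rose n) i ξ := rfl

theorem eval_phi (a : Unit → ℂ) (ζ : GraphModule (rose n)) (i : Fin n) :
    GraphModule.eval (rose n) i ((graphCorrespondence (rose n)).phi a ζ) =
      a () * GraphModule.eval (rose n) i ζ := rfl

theorem isCovariantRep_kE : (graphCorrespondence (rose n)).IsCovariantRep (kE n) (kA n) where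
  star_mul ξ η := by
    change _ = kA n (GraphModule.ip (rose n) ξ η)
    rw [kA_apply, ip_rose, kE_apply, kE_apply]
    simp [star_sum, Finset.sum_mul, Finset.mul_sum, star_S_mul_S, Algebra.algebraMap_eq_smul_one,
      smul_smul, mul_comm]
  map_phi a ξ := by
    simp [kE_apply, kA_apply, eval_phi, Algebra.algebraMap_eq_smul_one, Finset.smul_sum, smul_smul]
  covariant a _ m v w h := by
    -- Applied to `e_k` and read at coordinate `j`, the decomposition of `φ(a)` into rank-one
    -- operators says that the matrix `∑ v_i w_i^*` is `a` times the identity.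
    have hM : ∀ j k, ∑ i, starRingEnd ℂ (GraphModule.eval (rose n) k (w i)) *
        GraphModule.eval (rose n) j (v i) = if j = k then a () else 0 := fun j k => by
      have := congrArg (GraphModule.eval (rose n) j) (h (GraphModule.single (rose n) k))
      simp only [map_sum, eval_theta, eval_phi, ip_rose, GraphModule.eval_single, mul_ite, mul_one,
        mul_zero, Finset.sum_ite_eq', Finset.mem_univ, if_true] at this
      exact this.symm
    have hi : ∀ i, kE n (v i) * star (kE n (w i)) = ∑ j, ∑ k,
        (starRingEnd ℂ (GraphModule.eval (rose n) k (w i)) *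
          GraphModule.eval (rose n) j (v i)) • (S j * star (S k)) := fun i => by
      rw [kE_apply, kE_apply, star_sum, Finset.sum_mul_sum]
      simp [smul_smul]
    simp only [hi]
    rw [Finset.sum_comm]
    have : ∀ j : Fin n, ∑ i, ∑ k, (starRingEnd ℂ (GraphModule.eval (rose n) k (w i)) *
          GraphModule.eval (rose n) j (v i)) • (S j * star (S k)) =
        a () • (S j * star (S j)) := fun j => by
      rw [Finset.sum_comm]
      simp only [← Finset.sum_smul, hM]
      simp
    simp only [this]
    rw [← Finset.smul_sum, sum_S_mul_star_S, kA_apply, Algebra.algebraMap_eq_smul_one]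

theorem kE_single (i : Fin n) : kE n (GraphModule.single (rose n) i) = S i := by
  simp [kE_apply, GraphModule.eval_single]

theorem sum_eval_smul_single (ξ : GraphModule (rose n)) :
    ξ = ∑ i, GraphModule.eval (rose n) i ξ • GraphModule.single (rose n) i :=
  GraphModule.eval_ext _ fun e => by simp [GraphModule.eval_single]

/-- Orthonormality is the inner product relation on the basis. Completeness is covariance at `a =
1`, with `φ(1) = ∑ θ_{e_i, e_i}`; it requires a faithful left action, hence at least one loop. -/
theorem isCuntzFamily_of_isCovariantRep [NeZero n] {B : Type*} [CStarAlgebra B]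
    {t : GraphModule (rose n) →ₗ[ℂ] B} {π : (Unit → ℂ) →⋆ₐ[ℂ] B}
    (h : (graphCorrespondence (rose n)).IsCovariantRep t π) :
    IsCuntzFamily fun i => t (GraphModule.single (rose n) i) where
  orthonormal i j := by
    rw [h.star_mul]
    have : (graphCorrespondence (rose n)).inner (GraphModule.single (rose n) i)
        (GraphModule.single (rose n) j) = if i = j then 1 else 0 := by
      funext v
      change GraphModule.ip (rose n) _ _ v = _
      rw [ip_rose]
      split_ifs with hij <;> simp [GraphModule.eval_single, hij, eq_comm]
    rw [this]
    split_ifs <;> simp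
  complete := by
    have h1 := h.covariant 1 (fun b hb => ?_) n (GraphModule.single (rose n))
      (GraphModule.single (rose n)) (fun ζ => ?_)
    · rw [h1, map_one]
    -- Faithfulness of `φ`: the coordinate of `φ(b) e_0` at the loop `0` is `b` itself.
    · have := congrArg (GraphModule.eval (rose n) 0)
        (LinearMap.congr_fun hb (GraphModule.single (rose n) 0))
      rw [eval_phi, GraphModule.eval_single] at this
      funext v
      simpa using this
    · refine GraphModule.eval_ext _ fun e => ?_
      simp [eval_theta, ip_rose, GraphModule.eval_single]

theorem isPimsnerAlgebra [NeZero n] :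
    (graphCorrespondence (rose n)).IsPimsnerAlgebra.{w} (kE n) (kA n) where
  isCovariantRep := isCovariantRep_kE
  universal B _ t π h := by
    have hT := isCuntzFamily_of_isCovariantRep h
    refine ⟨lift _ hT, ⟨fun ξ => ?_, fun a => ?_⟩, fun Φ hΦ => hom_ext fun i => ?_⟩
    · rw [sum_eval_smul_single ξ]
      simp only [map_sum, map_smul, kE_single, lift_S]
    · rw [kA_apply, AlgHomClass.commutes]
      -- As `A = ℂ`, unitality alone determines `π`.
      have : a = algebraMap ℂ (Unit → ℂ) (a ()) := by ext; rfl
      conv_rhs => rw [this]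
      rw [AlgHomClass.commutes]
    · rw [lift_S, ← kE_single, hΦ.1]

end CuntzAlgebra

theorem theorem1p2 (n : ℕ) (hn : 2 ≤ n) :
    (graphCorrespondence (rose n)).IsPimsnerAlgebra.{w} (CuntzAlgebra.kE n) (CuntzAlgebra.kA n) ∧
    ∃ ρ : CuntzAlgebra n →⋆ₐ[ℂ] C(Fin n → Circle, CuntzAlgebra n),
      (∀ i, ρ (CuntzAlgebra.S i) = tmul (CuntzAlgebra.S i) 1 * CuntzAlgebra.u n) ∧
      (∀ ρ' : CuntzAlgebra n →⋆ₐ[ℂ] C(Fin n → Circle, CuntzAlgebra n),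
        (∀ i, ρ' (CuntzAlgebra.S i) = tmul (CuntzAlgebra.S i) 1 * CuntzAlgebra.u n) → ρ' = ρ) ∧
      IsGAction ρ ∧
      IsGaugeEquivariant (CuntzAlgebra.kE n) (CuntzAlgebra.kA n) ρ ∧
      ¬ IsLinearAction ρ ∧
      ¬ (graphCorrespondence (rose n)).IsLift (CuntzAlgebra.kE n) (CuntzAlgebra.kA n) ρ := by
  have : NeZero n := ⟨by omega⟩
  refine ⟨CuntzAlgebra.isPimsnerAlgebra, CuntzAlgebra.torusAction n, CuntzAlgebra.torusAction_S,
    fun ρ' h => CuntzAlgebra.hom_ext fun i => (h i).trans (CuntzAlgebra.torusAction_S i).symm,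
    CuntzAlgebra.isGAction_torusAction, CuntzAlgebra.isGaugeEquivariant_torusAction,
    CuntzAlgebra.not_isLinearAction_torusAction hn,
    fun h => CuntzAlgebra.not_isLinearAction_torusAction hn
      (CuntzAlgebra.isLinearAction_of_isLift h)⟩
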